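/- **Setting.** Let $\mathbb O$ be the octonions with basis $e_0,\dots,e_7$ and the multiplication $e_0e_i=e_ie_0=e_i$, $e_i^2=-e_0$ ($i\ge1$), $e_ie_j=-e_je_i$ ($1\le i<j\le 7$), and $e_1e_2=e_3,\ e_1e_3=-e_2,\ e_1e_4=e_5,\ e_1e_5=-e_4,\ e_1e_6=-e_7,\ e_1e_7=e_6,\ e_2e_3=e_1,\ e_2e_4=e_6,\ e_2e_5=e_7,\ e_2e_6=-e_4,\ e_2e_7=-e_5,\ e_3e_4=e_7,\ e_3e_5=-e_6,\ e_3e_6=e_5,\ e_3e_7=-e_4,\ e_4e_5=e_1,\ e_4e_6=e_2,\ e_4e_7=e_3,\ e_5e_6=-e_3,\ e_5e_7=e_2,\ e_6e_7=-e_1$. For $x=\sum_{\ell=0}^7x^\ell e_\ell$ write $\tilde x=(x^0,\dots,x^7)^T$, and let $M^\ell\in\mathbb R^{8\times8}$ be the matrix whose $(i,j)$ entry is the coefficient of $e_\ell$ in $e_ie_j$ ($i,j=0,\dots,7$). Consider the octonion-valued neural network with control $U$ $$\dot w_p(t)=-d_pw_p(t)+\sum_{q=1}^na_{pq}f_q(w_q(t))+\sum_{q=1}^nb_{pq}g_q(w_q(t-\tau_{pq}(t)))+I_p+U_p(t),\qquad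 p=1,\dots,n,\ t\ge 0,$$ where $d_p>0$, $a_{pq},b_{pq},I_p\in\mathbb O$, $f_q,g_q:\mathbb O\to\mathbb O$, $\tau_{pq}(t)\ge0$, with an arbitrary initial function on $(-\infty,0]$. **Assumption 1.** The partial derivatives of the components of $f_q,g_q$ with respect to the eight real coordinates exist, are continuous, and satisfy $0\le\partial f_q^{\ell_1}/\partial w^{\ell_2}\le\lambda_q^{\ell_1\ell_2}$ and $0\le\partial g_q^{\ell_1}/\partial w^{\ell_2}\le\delta_q^{\ell_1\ell_2}$ everywhere, with constants $\lambda_q^{\ell_1\ell_2},\delta_q^{\ell_1\ell_2}$. Put $\overline M(q,\lambda)=(\lambda_q^{\ell_1\ell_2})_{\ell_1,\ell_2}$, $\overline M(q,\delta)=(\delta_q^{\ell_1\ell_2})_{\ell_1,\ell_2}$, and let $\overline M_\ell(q,\lambda)$ be the $\ell$-th column of $\overline M(q,\lambda)$. **Assumption 2.** There is a continuous function $\tau$ on $[0,\infty)$ with $\tau_{pq}(t)\le\tau(t)$ for all $p,q$ and $t\ge0$, and $t-\tau(t)\to+\infty$ as $t\to+\infty$. **Assumption 3.** $\mu$ is a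 nondecreasing continuous function on $[0,\infty)$, differentiable for all large $t$, with $\mu(t)\to+\infty$, $\dot\mu(t)/\mu(t)\to\alpha\ge0$ and $\mu(t)/\mu(t-\tau(t))\to1+\beta\ge1$ as $t\to\infty$. **Controller.** Let $\hat Z^*=(\hat z^*_1,\dots,\hat z^*_n)\in\mathbb O^n$ be an arbitrary target, $\hat w_p(t)=w_p(t)-\hat z^*_p$, let $\kappa_p^\ell,\hat\kappa_p^\ell>0$, and let $$U_p^\ell(t)=-\operatorname{sign}(\hat w_p^\ell(t))\big(\kappa_p^\ell|\hat w_p^\ell(t)|+\hat\kappa_p^\ell\big),\qquad p=1,\dots,n,\ \ell=0,\dots,7 .$$ As this control is discontinuous, solutions are understood in the sense of Filippov: $w$ is absolutely continuous on every $[0,T]$ and satisfies the equation for almost every $t>0$, where $\operatorname{sign}(0)$ may be replaced by any value in $[-1,1]$ (for each $p$, $\ell$ and $t$ separately). Put $$\hat I_p^\ell=I_p^\ell-d_p(\hat z_p^*)^\ell+\sum_{q=1}^n\big[\tilde a_{pq}^TM^\ell\tilde f_q(\hat z_q^*)+\tilde b_{pq}^TM^\ell\tilde g_q(\hat z_q^*)\big].$$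 For vectors $\Lambda_p\in\mathbb R^8$, $p=1,\dots,n$, with positive entries $\Lambda_p[\ell]$, let $\Lambda_p^{[\ell]}$ be $\Lambda_p$ with its $\ell$-th entry replaced by $0$, and, with $|\cdot|$ and $\{\cdot\}^+=\max\{0,\cdot\}$ taken entrywise, let $$\begin{aligned}\overline T_\ell(p,\alpha,\beta)={}&\Lambda_p[\ell]\big[-d_p+\alpha+\{\tilde a_{pp}^TM^\ell\}^+\overline M_\ell(p,\lambda)\big]+|\tilde a_{pp}^TM^\ell|\,\overline M(p,\lambda)\Lambda_p^{[\ell]}\\&+\sum_{q\ne p}|\tilde a_{pq}^TM^\ell|\,\overline M(q,\lambda)\Lambda_q+(1+\beta)\sum_{q=1}^n|\tilde b_{pq}^TM^\ell|\,\overline M(q,\delta)\Lambda_q .\end{aligned}$$ **Theorem.** Suppose Assumptions 1, 2 and 3 hold. If there are positive vectors $\Lambda_1,\dots,\Lambda_n$ such that for all $p=1,\dots,n$ and $\ell=0,\dots,7$ $$\kappa_p^\ell>\Lambda_p[\ell]^{-1}\,\overline T_\ell(p,\alpha,\beta)\qquad\text{and}\qquad\hat\kappa_p^\ell>\sum_{q=1}^n|\tilde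 b_{pq}^TM^\ell|\,\overline M(q,\delta)\Lambda_q+|\hat I_p^\ell| ,$$ then the controlled network is globally finite-time stable at $\hat Z^*$: the constant function $\hat Z^*$ is a solution; it is Lyapunov stable, i.e. for every $\varepsilon>0$ there is $\delta>0$ such that every solution with $\|w(t)-\hat Z^*\|_\infty<\delta$ for all $t\le0$ satisfies $\|w(t)-\hat Z^*\|_\infty<\varepsilon$ for all $t\ge0$; and for every solution $w$ there is $T\ge0$ with $w(t)=\hat Z^*$ for all $t\ge T$. -/

import Mathlib

open MeasureTheory Filter Topology
open scoped Matrix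

noncomputable section

/-! ### Octonions -/

/-- An octonion `x = ∑ ℓ, x ℓ • e_ℓ`, given by its eight real coefficients. Addition and real scalar
multiplication are coefficientwise; the product is `Octonion.mul` below. -/
abbrev Octonion : Type := Fin 8 → ℝ

/-- `e_i * e_j = ± e_k`; this table gives the index `k`. -/
def octIndex : Matrix (Fin 8) (Fin 8) (Fin 8) :=
  !![0, 1, 2, 3, 4, 5, 6, 7;
     1, 0, 3, 2, 5, 4, 7, 6;
     2, 3, 0, 1, 6, 7, 4, 5;
     3, 2, 1, 0, 7, 6, 5, 4;
     4, 5, 6, 7, 0, 1, 2, 3;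
     5, 4, 7, 6, 1, 0, 3, 2;
     6, 7, 4, 5, 2, 3, 0, 1;
     7, 6, 5, 4, 3, 2, 1, 0]

/-- `e_i * e_j = ± e_k`; this table gives the sign. -/
def octSign : Matrix (Fin 8) (Fin 8) ℝ :=
  !![1,  1,  1,  1,  1,  1,  1,  1;
     1, -1,  1, -1,  1, -1, -1,  1;
     1, -1, -1,  1,  1,  1, -1, -1;
     1,  1, -1, -1,  1, -1,  1, -1;
     1, -1, -1, -1, -1,  1,  1,  1;
     1,  1, -1,  1, -1, -1, -1,  1;
     1,  1,  1, -1, -1,  1, -1, -1;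
     1, -1,  1,  1, -1, -1,  1, -1]

/-- The structure matrix `M^ℓ`: its `(i, j)` entry is the coefficient of `e_ℓ` in `e_i * e_j`. -/
def octM (ℓ : Fin 8) : Matrix (Fin 8) (Fin 8) ℝ :=
  Matrix.of fun i j => if octIndex i j = ℓ then octSign i j else 0

/-- The octonion product; its `ℓ`-th coefficient is `aᵀ M^ℓ b`. -/
def Octonion.mul (a b : Octonion) : Octonion := fun ℓ => (a ᵥ* octM ℓ) ⬝ᵥ b

/-! ### The network, the controller and the solutions of the closed loop -/

/-- The data of an octonion-valued neural network with `n` neurons and time-varying delays. -/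
structure OVNN (n : ℕ) where
  /-- self-feedback rates `d_p` -/
  d : Fin n → ℝ
  /-- undelayed connection weights `a_pq` -/
  a : Fin n → Fin n → Octonion
  /-- delayed connection weights `b_pq` -/
  b : Fin n → Fin n → Octonion
  /-- undelayed activation functions `f_q` -/
  f : Fin n → Octonion → Octonion
  /-- delayed activation functions `g_q` -/
  g : Fin n → Octonion → Octonion
  /-- transmission delays `τ_pq(t)` -/
  delay : Fin n → Fin n → ℝ → ℝ
  /-- external inputs `I_p` -/
  input : Fin n → Octonion

namespace OVNN

variable {n : ℕ} (N : OVNN n)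

/-- The uncontrolled right-hand side
`-d_p w_p(t) + ∑ a_pq f_q(w_q(t)) + ∑ b_pq g_q(w_q(t - τ_pq(t))) + I_p`. -/
def rhs (w : ℝ → Fin n → Octonion) (t : ℝ) (p : Fin n) : Octonion :=
  -(N.d p • w t p) + ∑ q, (N.a p q).mul (N.f q (w t q))
    + ∑ q, (N.b p q).mul (N.g q (w (t - N.delay p q t) q)) + N.input p

/-- The constant input `Î_p` that remains in the equation of the error `w - z` to the target `z`. -/
def inputHat (z : Fin n → Octonion) (p : Fin n) : Octonion :=
  N.input p - N.d p • z p
    + ∑ q, ((N.a p q).mul (N.f q (z q)) + (N.b p q).mul (N.g q (z q)))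

end OVNN

/-- The set-valued sign: `{1}` for `x > 0`, `{-1}` for `x < 0`, and `[-1, 1]` at `x = 0`. -/
def signSet (x : ℝ) : Set ℝ :=
  {s | -1 ≤ s ∧ s ≤ 1 ∧ (0 < x → s = 1) ∧ (x < 0 → s = -1)}

/-- The single-valued sign is a selection of the set-valued one. -/
theorem sign_mem_signSet (x : ℝ) : Real.sign x ∈ signSet x := by
  rcases lt_trichotomy x 0 with h | h | h
  · simp [signSet, Real.sign_of_neg h, h, not_lt.mpr h.le]
  · simp [signSet, h]
  · simp [signSet, Real.sign_of_pos h, not_lt.mpr h.le]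

/-- The values at the error `x` of the (Filippov regularization of the) state-feedback controller
`-sign(x) (κ |x| + κ')`. -/
def controlSet (κ κ' x : ℝ) : Set ℝ := {u | ∃ s ∈ signSet x, u = -s * (κ * |x| + κ')}

/-- `w` is a (Filippov) solution on `[0, ∞)` of the network controlled towards the target `z`: it is
absolutely continuous on every `[0, T]`, and for almost every `t > 0` it satisfies
`(w_p^ℓ)'(t) = (rhs)_p^ℓ(t) + U_p^ℓ(t)` with an admissible control value `U_p^ℓ(t)`. The values of
`w` at negative times are the initial function of the delay equation, which is arbitrary. Since the
single-valued sign is a selection of the set-valued one, all classical and all Carathéodory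
solutions are included. -/
def OVNN.IsControlledSolution {n : ℕ} (N : OVNN n) (κ κ' : Fin n → Fin 8 → ℝ)
    (z : Fin n → Octonion) (w : ℝ → Fin n → Octonion) : Prop :=
  (∀ p ℓ, ∀ T > 0, AbsolutelyContinuousOnInterval (fun t => w t p ℓ) 0 T) ∧
  ∀ᵐ t, 0 < t → ∀ p ℓ, ∃ u ∈ controlSet (κ p ℓ) (κ' p ℓ) (w t p ℓ - z p ℓ),
    HasDerivAt (fun s => w s p ℓ) (N.rhs w t p ℓ + u) t

/-- Global finite-time stability of the point `z` for the system with solution set `Sol`: `z` is an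
equilibrium, it is Lyapunov stable, and every solution reaches `z` in finite time and stays there.
(The norm is the maximum norm.) -/
structure IsFiniteTimeStable {n : ℕ} (Sol : Set (ℝ → Fin n → Octonion)) (z : Fin n → Octonion) :
    Prop where
  equilibrium : (fun _ => z) ∈ Sol
  lyapunov : ∀ ε > 0, ∃ δ > 0, ∀ w ∈ Sol, (∀ t ≤ 0, ‖w t - z‖ < δ) → ∀ t ≥ 0, ‖w t - z‖ < ε
  convergence : ∀ w ∈ Sol, ∃ T ≥ 0, ∀ t ≥ T, w t = z

/-! ### The assumptions -/

/-- The partial derivatives of all components of `F` exist, are continuous, and satisfy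
`0 ≤ ∂F^ℓ₁/∂x^ℓ₂ ≤ B ℓ₁ ℓ₂`. -/
structure HasPartialBounds (F : Octonion → Octonion) (B : Matrix (Fin 8) (Fin 8) ℝ) : Prop where
  exist : ∀ ℓ₁ ℓ₂ x, LineDifferentiableAt ℝ (fun y => F y ℓ₁) x (Pi.single ℓ₂ 1)
  cont : ∀ ℓ₁ ℓ₂, Continuous fun x => lineDeriv ℝ (fun y => F y ℓ₁) x (Pi.single ℓ₂ 1)
  nonneg : ∀ ℓ₁ ℓ₂ x, 0 ≤ lineDeriv ℝ (fun y => F y ℓ₁) x (Pi.single ℓ₂ 1)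
  le : ∀ ℓ₁ ℓ₂ x, lineDeriv ℝ (fun y => F y ℓ₁) x (Pi.single ℓ₂ 1) ≤ B ℓ₁ ℓ₂

/-- The delays are bounded by a continuous function `τ` with `t - τ(t) → ∞`. -/
structure HasDelayBound {n : ℕ} (delay : Fin n → Fin n → ℝ → ℝ) (τ : ℝ → ℝ) : Prop where
  nonneg : ∀ p q, ∀ t ≥ 0, 0 ≤ delay p q t
  le : ∀ p q, ∀ t ≥ 0, delay p q t ≤ τ t
  cont : ContinuousOn τ (Set.Ici 0)
  tendsto : Tendsto (fun t => t - τ t) atTop atTop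

/-- `μ` is nondecreasing and continuous on `[0, ∞)`, `μ(t) → ∞`, `μ'(t)/μ(t) → α ≥ 0` and
`μ(t)/μ(t - τ(t)) → 1 + β ≥ 1`. -/
structure IsRateFunction (μ τ : ℝ → ℝ) (α β : ℝ) : Prop where
  mono : MonotoneOn μ (Set.Ici 0)
  cont : ContinuousOn μ (Set.Ici 0)
  tendsto : Tendsto μ atTop atTop
  differentiable : ∀ᶠ t in atTop, DifferentiableAt ℝ μ t
  logDeriv_tendsto : Tendsto (fun t => deriv μ t / μ t) atTop (𝓝 α)
  ratio_tendsto : Tendsto (fun t => μ t / μ (t - τ t)) atTop (𝓝 (1 + β))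
  alpha_nonneg : 0 ≤ α
  beta_nonneg : 0 ≤ β

/-! ### The quantities in the gain conditions -/

/-- Entrywise positive part of a vector. -/
def posVec (v : Fin 8 → ℝ) : Fin 8 → ℝ := fun i => max 0 (v i)

/-- Entrywise absolute value of a vector. -/
def absVec (v : Fin 8 → ℝ) : Fin 8 → ℝ := fun i => |v i|

namespace OVNN

variable {n : ℕ} (N : OVNN n)

/-- The quantity `T̄_ℓ(p, α, β)`. Here `lam q` and `del q` are the matrices of the bounds on the
partial derivatives of `f_q` and `g_q`, `fun i => lam p i ℓ` is the `ℓ`-th column of `lam p`, and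
`Function.update (Λ p) ℓ 0` is `Λ_p` with its `ℓ`-th entry replaced by zero. -/
def TBar (lam del : Fin n → Matrix (Fin 8) (Fin 8) ℝ) (Λ : Fin n → Fin 8 → ℝ)
    (ℓ : Fin 8) (p : Fin n) (α β : ℝ) : ℝ :=
  Λ p ℓ * (-N.d p + α + posVec (N.a p p ᵥ* octM ℓ) ⬝ᵥ (fun i => lam p i ℓ))
  + (absVec (N.a p p ᵥ* octM ℓ) ᵥ* lam p) ⬝ᵥ Function.update (Λ p) ℓ 0
  + ∑ q ∈ Finset.univ.erase p, (absVec (N.a p q ᵥ* octM ℓ) ᵥ* lam q) ⬝ᵥ Λ q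
  + (1 + β) * ∑ q, (absVec (N.b p q ᵥ* octM ℓ) ᵥ* del q) ⬝ᵥ Λ q

/-- The bound `∑ q, |b_pqᵀ M^ℓ| M̄(q, δ) Λ_q` on the delayed coupling. -/
def delayedBound (del : Fin n → Matrix (Fin 8) (Fin 8) ℝ) (Λ : Fin n → Fin 8 → ℝ)
    (ℓ : Fin 8) (p : Fin n) : ℝ :=
  ∑ q, (absVec (N.b p q ᵥ* octM ℓ) ᵥ* del q) ⬝ᵥ Λ q

end OVNN

end

/-! ### Absolutely continuous functions with an almost everywhere differential inequality -/

/-! Let V(t) be the maximum over (p, ℓ) of |w_p^ℓ(t) - z_p^ℓ| / Λ_p[ℓ], and let D be `delayedBound`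
at a maximizing index. If V ≤ L on the delay window and L ≤ V(t) + 1, the delayed coupling
contributes at most L D ≤ V(t) D + D. The gain κ pays for everything proportional to V(t), because
`TBar` with α, β ≥ 0 dominates those terms; the constant gain κ' pays for the remaining D + |Î|.
Hence V' ≤ -η almost everywhere that V is positive and within 1 of its window supremum
(`sign_mul_velocity_le`, `decreasesNearWindowSup`).

Such a V cannot rise above a nonnegative bound on its past, which gives Lyapunov stability
(`le_of_past_le`). The slack 1 gives finite time: once the windows lie where V ≤ L, V falls at rate
η to max(L - 1, 0), so finitely many such steps reach 0 (`exists_forall_ge_nonpos`). -/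

theorem AbsolutelyContinuousOnInterval.of_dist_le_sum {X Y ι : Type*} [PseudoMetricSpace X]
    [PseudoMetricSpace Y] {f : ℝ → X} {g : ι → ℝ → Y} {s : Finset ι} {a b : ℝ}
    (hg : ∀ i ∈ s, AbsolutelyContinuousOnInterval (g i) a b)
    (h : ∀ x y, dist (f x) (f y) ≤ ∑ i ∈ s, dist (g i x) (g i y)) :
    AbsolutelyContinuousOnInterval f a b := by
  have key := tendsto_finsetSum s hg
  rw [Finset.sum_const_zero] at key
  refine squeeze_zero (fun E => Finset.sum_nonneg fun i _ => dist_nonneg) (fun E => ?_) key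
  rw [Finset.sum_comm]
  exact Finset.sum_le_sum fun i _ => h _ _

theorem AbsolutelyContinuousOnInterval.sub_le_of_deriv_le {V : ℝ → ℝ} {a b C : ℝ} (hab : a ≤ b)
    (hV : AbsolutelyContinuousOnInterval V a b)
    (h : ∀ᵐ t, a < t → t < b → deriv V t ≤ C) : V b - V a ≤ C * (b - a) := by
  rw [← hV.integral_deriv_eq_sub]
  have hb : ∀ᵐ t : ℝ, t ≠ b := by simp [ae_iff]
  have h1 : ∫ t in a..b, deriv V t ≤ ∫ _ in a..b, C := by
    refine intervalIntegral.integral_mono_ae_restrict hab hV.intervalIntegrable_deriv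
      intervalIntegrable_const ?_
    have ha : ∀ᵐ t : ℝ, t ≠ a := by simp [ae_iff]
    refine (ae_restrict_iff' measurableSet_Icc).2 ?_
    filter_upwards [h, ha, hb] with t ht hta htb hmem
    exact ht (lt_of_le_of_ne hmem.1 hta.symm) (lt_of_le_of_ne hmem.2 htb)
  simpa [mul_comm] using h1

/-- A function which, at every new maximum above `c`, decreases on a left neighbourhood of it, can
not exceed `c`. -/
theorem le_of_deriv_le_neg_near_max {V : ℝ → ℝ} {t₀ c η : ℝ} (hη : 0 < η)
    (hAC : ∀ T > t₀, AbsolutelyContinuousOnInterval V t₀ T) (h₀ : V t₀ ≤ c)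
    (h : ∀ t₁ > t₀, c < V t₁ → (∀ s ∈ Set.Icc t₀ t₁, V s ≤ V t₁) →
      ∃ θ < V t₁, ∀ᵐ t, t₀ < t → t < t₁ → θ < V t → deriv V t ≤ -η) :
    ∀ t ≥ t₀, V t ≤ c := by
  intro t₂ ht₂
  by_contra! hlt
  have ht₂' : t₀ < t₂ := lt_of_le_of_ne ht₂ (by rintro rfl; linarith)
  have hcont : ContinuousOn V (Set.Icc t₀ t₂) := by
    simpa [Set.uIcc_of_le ht₂] using (hAC t₂ ht₂').continuousOn
  obtain ⟨t₁, ht₁, hmax⟩ := isCompact_Icc.exists_isMaxOn ⟨t₂, ht₂, le_rfl⟩ hcont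
  have hV₁ : c < V t₁ := hlt.trans_le (hmax ⟨ht₂, le_rfl⟩)
  have ht₁' : t₀ < t₁ := lt_of_le_of_ne ht₁.1 (by rintro rfl; linarith)
  obtain ⟨θ, hθ, hdec⟩ := h t₁ ht₁' hV₁ fun s hs => hmax ⟨hs.1, hs.2.trans ht₁.2⟩
  have hnear : ∀ᶠ s in 𝓝[<] t₁, θ < V s := by
    have h1 : ContinuousWithinAt V (Set.Iio t₁) t₁ :=
      (hcont t₁ ht₁).mono_of_mem_nhdsWithin
        (mem_of_superset (Ioo_mem_nhdsLT ht₁') fun s hs => ⟨hs.1.le, hs.2.le.trans ht₁.2⟩)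
    exact h1.eventually (lt_mem_nhds hθ)
  obtain ⟨l, hl, hlV⟩ := (mem_nhdsLT_iff_exists_Ioo_subset' ht₁').1 hnear
  obtain ⟨a, ha₁, ha₂⟩ := exists_between (max_lt (show l < t₁ from hl) ht₁')
  have hat₀ : t₀ < a := (le_max_right _ _).trans_lt ha₁
  have hla : l < a := (le_max_left _ _).trans_lt ha₁
  have hsub := ((hAC t₁ ht₁').mono (by
    rw [Set.uIcc_of_le ha₂.le, Set.uIcc_of_le ht₁'.le]
    exact Set.Icc_subset_Icc_left hat₀.le)).sub_le_of_deriv_le (C := -η) ha₂.le (by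
      filter_upwards [hdec] with t ht h1 h2
      exact ht (hat₀.trans h1) h2 (hlV ⟨hla.trans h1, h2⟩))
  have hmaxa : V a ≤ V t₁ := hmax ⟨hat₀.le, ha₂.le.trans ht₁.2⟩
  -- Decrease on [a, t₁] forces V a ≥ V t₁ + η (t₁ - a), against maximality at t₁.
  nlinarith [mul_pos hη (sub_pos.2 ha₂)]

/-- If `V` decreases with a uniform rate wherever it exceeds `c`, then it is eventually at most
`c`. -/
theorem exists_forall_ge_le_of_deriv_le_neg {V : ℝ → ℝ} {t₀ c η : ℝ} (hη : 0 < η)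
    (hAC : ∀ T > t₀, AbsolutelyContinuousOnInterval V t₀ T)
    (h : ∀ᵐ t, t₀ < t → c < V t → deriv V t ≤ -η) :
    ∃ S ≥ t₀, ∀ t ≥ S, V t ≤ c := by
  obtain ⟨S, hS, hVS⟩ : ∃ S ≥ t₀, V S ≤ c := by
    by_contra! hcon
    -- Long enough for a decrease at rate η to exceed V t₀ - c.
    set T := t₀ + (|V t₀ - c| + 1) / η with hT
    have hpos : 0 < (|V t₀ - c| + 1) / η := by positivity
    have htT : t₀ < T := by linarith
    have hsub := (hAC T htT).sub_le_of_deriv_le (C := -η) htT.le (by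
      filter_upwards [h] with t ht h1 _
      exact ht h1 (hcon t h1.le))
    have h1 : -η * (T - t₀) = -(|V t₀ - c| + 1) := by
      rw [hT]; field_simp; ring
    have h2 := hcon T htT.le
    have h3 := le_abs_self (V t₀ - c)
    linarith
  refine ⟨S, hS, le_of_deriv_le_neg_near_max hη (fun T hT => ?_) hVS fun t₁ _ hV₁ _ => ?_⟩
  · refine (hAC T (lt_of_le_of_lt hS hT)).mono ?_
    rw [Set.uIcc_of_le hT.le, Set.uIcc_of_le (hS.trans hT.le)]
    exact Set.Icc_subset_Icc_left hS
  · refine ⟨c, hV₁, ?_⟩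
    filter_upwards [h] with t ht h1 _
    exact ht (hS.trans_lt h1)

/-! ### A Halanay-type inequality with a jump term -/

/-- At almost every time `t > t₀` at which `V` is positive and within distance `1` of its supremum
over the delay window `[t - τ t, t]`, it decreases at least with rate `η`. -/
def DecreasesNearWindowSup (V τ : ℝ → ℝ) (η t₀ : ℝ) : Prop :=
  ∀ᵐ t, t₀ < t → ∀ L, (∀ s ∈ Set.Icc (t - τ t) t, V s ≤ L) → max (L - 1) 0 < V t →
    deriv V t ≤ -η

/-- At a new maximum t₁ above c, V t₁ itself bounds V on the window of every earlier t > t₀: before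
t₀ by the past bound, after t₀ by maximality. So V would decrease just before t₁. The set P locates
the windows, so that the past bound is needed only where they reach. -/
theorem DecreasesNearWindowSup.le_of_past_le {V τ : ℝ → ℝ} {η t₀ c : ℝ} {P : Set ℝ}
    (h : DecreasesNearWindowSup V τ η t₀) (hη : 0 < η)
    (hAC : ∀ T > t₀, AbsolutelyContinuousOnInterval V t₀ T) (hc : 0 ≤ c)
    (hP : ∀ t > t₀, Set.Icc (t - τ t) t ⊆ P) (hpast : ∀ s ∈ P, s ≤ t₀ → V s ≤ c)
    (h₀ : V t₀ ≤ c) : ∀ t ≥ t₀, V t ≤ c := by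
  refine le_of_deriv_le_neg_near_max hη hAC h₀ fun t₁ _ hV₁ hmax => ?_
  refine ⟨max (V t₁ - 1) 0, max_lt (by linarith) (hc.trans_lt hV₁), ?_⟩
  filter_upwards [h] with t ht h1 h2 h3
  refine ht h1 (V t₁) (fun s hs => ?_) h3
  rcases le_total s t₀ with hs₀ | hs₀
  · exact (hpast s (hP t h1 hs) hs₀).trans hV₁.le
  · exact hmax s ⟨hs₀, hs.2.trans h2.le⟩

theorem DecreasesNearWindowSup.exists_forall_ge_nonpos {V τ : ℝ → ℝ} {η : ℝ}
    (h : DecreasesNearWindowSup V τ η 0) (hη : 0 < η)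
    (hAC : ∀ T > 0, AbsolutelyContinuousOnInterval V 0 T)
    (hτ : Tendsto (fun t => t - τ t) atTop atTop) :
    ∃ T ≥ 0, ∀ t ≥ T, V t ≤ 0 := by
  have hAC' : ∀ S ≥ 0, ∀ T > S, AbsolutelyContinuousOnInterval V S T := fun S hS T hT =>
    (hAC T (lt_of_le_of_lt hS hT)).mono (by
      rw [Set.uIcc_of_le hT.le, Set.uIcc_of_le (hS.trans hT.le)]
      exact Set.Icc_subset_Icc_left hS)
  have hev : ∀ S : ℝ, ∃ R ≥ S, ∀ t ≥ R, S ≤ t - τ t := fun S => by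
    obtain ⟨R, hR⟩ := eventually_atTop.1 (hτ.eventually_ge_atTop S)
    exact ⟨max R S, le_max_right _ _, fun t ht => hR t ((le_max_left _ _).trans ht)⟩
  have hmono : ∀ S ≥ 0, DecreasesNearWindowSup V τ η S := fun S hS => by
    filter_upwards [h] with t ht h1
    exact ht (lt_of_le_of_lt hS h1)
  obtain ⟨L, hL⟩ : ∃ L, ∀ t ≥ 0, V t ≤ L := by
    obtain ⟨R, hR0, hR⟩ := hev 0
    -- The initial function may be unbounded, so the bound starts at a time R after which no window
    -- meets negative times. R may be 0, hence R + 1.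
    obtain ⟨C, hC⟩ := (hAC (R + 1) (by linarith)).exists_bound
    rw [Set.uIcc_of_le (by linarith)] at hC
    have hC' : ∀ t ∈ Set.Icc 0 R, V t ≤ C := fun t ht =>
      (le_abs_self _).trans (hC t ⟨ht.1, ht.2.trans (by linarith)⟩)
    have hC0 : 0 ≤ C := (norm_nonneg _).trans (hC 0 ⟨le_rfl, by linarith⟩)
    refine ⟨C, fun t ht => ?_⟩
    rcases le_total t R with htR | htR
    · exact hC' t ⟨ht, htR⟩
    · exact (hmono R hR0).le_of_past_le hη (hAC' R hR0) hC0 (P := Set.Ici 0)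
        (fun t ht s hs => (hR t (le_of_lt ht)).trans hs.1)
        (fun s hs hsR => hC' s ⟨hs, hsR⟩) (hC' R ⟨hR0, le_rfl⟩) t htR
  have hstep : ∀ k : ℕ, ∃ S ≥ 0, ∀ t ≥ S, V t ≤ max (L - k) 0 := fun k => by
    induction k with
    | zero => exact ⟨0, le_rfl, fun t ht => (hL t ht).trans (by simp)⟩
    | succ k ih =>
      obtain ⟨S, hS, hVS⟩ := ih
      obtain ⟨R, hRS, hR⟩ := hev S
      have hR0 : 0 ≤ R := le_trans hS hRS
      -- Beyond R all windows lie where V ≤ max (L - k) 0, so V decreases as long as it exceeds the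
      -- next level.
      obtain ⟨S', hS', hV⟩ := exists_forall_ge_le_of_deriv_le_neg (c := max (L - (k + 1 : ℕ)) 0)
        hη (hAC' R hR0) (by
          filter_upwards [h] with t ht h1 h2
          refine ht (hR0.trans_lt h1) (max (L - k) 0)
            (fun s hs => hVS s ((hR t h1.le).trans hs.1)) (lt_of_le_of_lt ?_ h2)
          push_cast
          refine max_le ?_ (le_max_right _ _)
          rcases max_cases (L - (k : ℝ)) 0 with ⟨h3, _⟩ | ⟨h3, _⟩ <;> rw [h3]
          · exact le_max_of_le_left (by linarith)
          · exact le_max_of_le_right (by linarith))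
      exact ⟨S', hR0.trans hS', hV⟩
  obtain ⟨k, hk⟩ := exists_nat_ge L
  obtain ⟨S, hS, hVS⟩ := hstep k
  exact ⟨S, hS, fun t ht => (hVS t ht).trans (max_le (by linarith) le_rfl)⟩

/-! ### The derivative of the maximum norm along a curve -/

/-- The function ‖x s‖ - sign(x t k) · x s k is nonnegative and vanishes at s = t, so its derivative
there is zero. No uniqueness of the maximizing coordinate is needed. -/
theorem deriv_norm_eq_sign_mul {ι : Type*} [Fintype ι] {x : ℝ → ι → ℝ} {t x' : ℝ} {k : ι}
    (hd : DifferentiableAt ℝ (fun s => ‖x s‖) t) (hk : |x t k| = ‖x t‖)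
    (hx : HasDerivAt (fun s => x s k) x' t) :
    deriv (fun s => ‖x s‖) t = Real.sign (x t k) * x' := by
  have hs : ∀ y : ℝ, Real.sign (x t k) * y ≤ |y| := fun y => by
    rcases Real.sign_apply_eq (x t k) with h | h | h <;> rw [h]
    · linarith [neg_le_abs y]
    · simp
    · linarith [le_abs_self y]
  have hmin : IsLocalMin (fun s => ‖x s‖ - Real.sign (x t k) * x s k) t := by
    refine Eventually.of_forall fun s => ?_
    have h1 : Real.sign (x t k) * x t k = ‖x t‖ := by
      rw [← hk]
      rcases lt_trichotomy (x t k) 0 with h | h | h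
      · rw [Real.sign_of_neg h, abs_of_neg h]; ring
      · simp [h]
      · rw [Real.sign_of_pos h, abs_of_pos h]; ring
    have h2 : |x s k| ≤ ‖x s‖ := norm_le_pi_norm (x s) k
    simp only [h1, sub_self]
    linarith [hs (x s k)]
  have := hmin.hasDerivAt_eq_zero (hd.hasDerivAt.sub (hx.const_mul _))
  linarith

/-! ### The mean value theorem for activation functions -/

theorem HasPartialBounds.exists_update_sub {F : Octonion → Octonion}
    {B : Matrix (Fin 8) (Fin 8) ℝ} (h : HasPartialBounds F B) (i j : Fin 8) (x : Octonion)
    (b : ℝ) : ∃ c, 0 ≤ c ∧ c ≤ B i j ∧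
      F (Function.update x j b) i - F x i = c * (b - x j) := by
  set φ : ℝ → ℝ := fun s => F (Function.update x j s) i with hφ
  have hder : ∀ s, ∃ c, 0 ≤ c ∧ c ≤ B i j ∧ HasDerivAt φ c s := fun s => by
    have h1 := (h.exist i j (Function.update x j s)).hasLineDerivAt
    refine ⟨_, h.nonneg i j (Function.update x j s), h.le i j _, ?_⟩
    have h2 := HasDerivAt.scomp_of_eq s h1 ((hasDerivAt_id s).sub_const s) (by simp)
    rw [one_smul] at h2
    refine h2.congr_of_eventuallyEq (Eventually.of_forall fun r => ?_)
    simp only [hφ, Function.comp_apply, id]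
    congr 1
    ext m
    by_cases hm : m = j
    · subst hm; simp
    · simp [hm]
  choose c hc0 hcB hc using hder
  have hx : φ (x j) = F x i := by simp [hφ]
  have hcont : Continuous φ := continuous_iff_continuousAt.2 fun s => (hc s).continuousAt
  rcases lt_trichotomy (x j) b with hlt | heq | hlt
  · obtain ⟨s, -, hs⟩ := exists_hasDerivAt_eq_slope φ c hlt hcont.continuousOn fun s _ => hc s
    refine ⟨c s, hc0 s, hcB s, ?_⟩
    rw [hs, ← hx, div_mul_cancel₀ _ (sub_pos.2 hlt).ne']
  · refine ⟨c b, hc0 b, hcB b, ?_⟩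
    rw [← hx, heq]; simp [hφ]
  · obtain ⟨s, -, hs⟩ := exists_hasDerivAt_eq_slope φ c hlt hcont.continuousOn fun s _ => hc s
    refine ⟨c s, hc0 s, hcB s, ?_⟩
    rw [hs, ← hx, ← neg_sub (x j) b, mul_neg, div_mul_cancel₀ _ (sub_pos.2 hlt).ne', neg_sub]

/-- Pass from x to y one coordinate at a time and apply the one-variable mean value theorem to each
change. The intermediate points depend on the entry, so C need not be a Jacobian at a single point.
-/
theorem HasPartialBounds.exists_sub_eq_mulVec {F : Octonion → Octonion}
    {B : Matrix (Fin 8) (Fin 8) ℝ} (h : HasPartialBounds F B) (x y : Octonion) :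
    ∃ C : Matrix (Fin 8) (Fin 8) ℝ, (∀ i j, 0 ≤ C i j) ∧ (∀ i j, C i j ≤ B i j) ∧
      F y - F x = C *ᵥ (y - x) := by
  have key : ∀ (i : Fin 8) (s : Finset (Fin 8)), ∃ c : Fin 8 → ℝ, (∀ j, 0 ≤ c j) ∧
      (∀ j, c j ≤ B i j) ∧ F (s.piecewise y x) i - F x i = ∑ j ∈ s, c j * (y j - x j) := by
    intro i s
    induction s using Finset.induction_on with
    | empty =>
      exact ⟨fun _ => 0, fun _ => le_rfl, fun j => (h.nonneg i j 0).trans (h.le i j 0), by simp⟩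
    | insert j s hj ih =>
      obtain ⟨c, hc0, hcB, hc⟩ := ih
      obtain ⟨r, hr0, hrB, hr⟩ := h.exists_update_sub i j (s.piecewise y x) (y j)
      refine ⟨Function.update c j r, fun m => ?_, fun m => ?_, ?_⟩
      · by_cases hm : m = j
        · subst hm; simpa using hr0
        · simpa [hm] using hc0 m
      · by_cases hm : m = j
        · subst hm; simpa using hrB
        · simpa [hm] using hcB m
      · rw [Finset.piecewise_insert, Finset.sum_insert hj, Function.update_self,
          Finset.sum_congr rfl (g := fun m => c m * (y m - x m)), ← hc]
        · rw [Finset.piecewise_eq_of_notMem _ _ _ hj] at hr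
          linarith
        · intro m hm
          rw [Function.update_of_ne (ne_of_mem_of_not_mem hm hj)]
  choose C hC0 hCB hC using fun i => key i Finset.univ
  refine ⟨C, hC0, hCB, ?_⟩
  ext i
  simpa [Matrix.mulVec, dotProduct] using hC i

/-! ### Bounds on the coupling terms -/

theorem abs_vecMul_le {a : Fin 8 → ℝ} {B C : Matrix (Fin 8) (Fin 8) ℝ} (hC0 : ∀ i j, 0 ≤ C i j)
    (hCB : ∀ i j, C i j ≤ B i j) (j : Fin 8) : |(a ᵥ* C) j| ≤ (absVec a ᵥ* B) j := by
  change |∑ i, a i * C i j| ≤ ∑ i, |a i| * B i j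
  refine (Finset.abs_sum_le_sum_abs _ _).trans (Finset.sum_le_sum fun i _ => ?_)
  rw [abs_mul, abs_of_nonneg (hC0 i j)]
  exact mul_le_mul_of_nonneg_left (hCB i j) (abs_nonneg _)

theorem vecMul_le_posVec {a : Fin 8 → ℝ} {B C : Matrix (Fin 8) (Fin 8) ℝ}
    (hC0 : ∀ i j, 0 ≤ C i j) (hCB : ∀ i j, C i j ≤ B i j) (j : Fin 8) :
    (a ᵥ* C) j ≤ posVec a ⬝ᵥ fun i => B i j := by
  change ∑ i, a i * C i j ≤ ∑ i, max 0 (a i) * B i j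
  refine Finset.sum_le_sum fun i _ => ?_
  exact (mul_le_mul_of_nonneg_right (le_max_right 0 (a i)) (hC0 i j)).trans
    (mul_le_mul_of_nonneg_left (hCB i j) (le_max_left _ _))

theorem abs_dotProduct_mulVec_le {a x Λ : Fin 8 → ℝ} {B C : Matrix (Fin 8) (Fin 8) ℝ} {r : ℝ}
    (hC0 : ∀ i j, 0 ≤ C i j) (hCB : ∀ i j, C i j ≤ B i j) (hx : ∀ j, |x j| ≤ r * Λ j) :
    |a ⬝ᵥ (C *ᵥ x)| ≤ r * ((absVec a ᵥ* B) ⬝ᵥ Λ) := by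
  rw [Matrix.dotProduct_mulVec, dotProduct, dotProduct, Finset.mul_sum]
  refine (Finset.abs_sum_le_sum_abs _ _).trans (Finset.sum_le_sum fun j _ => ?_)
  rw [abs_mul]
  calc |(a ᵥ* C) j| * |x j| ≤ (absVec a ᵥ* B) j * (r * Λ j) :=
        mul_le_mul (abs_vecMul_le hC0 hCB j) (hx j) (abs_nonneg _)
          ((abs_nonneg _).trans (abs_vecMul_le hC0 hCB j))
    _ = r * ((absVec a ᵥ* B) j * Λ j) := by ring

/-- In the direction of the `ℓ`-th coordinate, at which the weighted maximum norm is attained, the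
diagonal coefficient contributes only through its positive part. -/
theorem sign_mul_dotProduct_mulVec_le {a x Λ : Fin 8 → ℝ} {B C : Matrix (Fin 8) (Fin 8) ℝ}
    {r : ℝ} {ℓ : Fin 8} (hC0 : ∀ i j, 0 ≤ C i j) (hCB : ∀ i j, C i j ≤ B i j)
    (hx : ∀ j, |x j| ≤ r * Λ j) (hℓ : |x ℓ| = r * Λ ℓ) :
    Real.sign (x ℓ) * (a ⬝ᵥ (C *ᵥ x)) ≤
      r * (Λ ℓ * (posVec a ⬝ᵥ fun i => B i ℓ)
        + (absVec a ᵥ* B) ⬝ᵥ Function.update Λ ℓ 0) := by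
  have hs : |Real.sign (x ℓ)| ≤ 1 := by
    rcases Real.sign_apply_eq (x ℓ) with h | h | h <;> simp [h]
  have hsx : Real.sign (x ℓ) * x ℓ = |x ℓ| := by
    rcases lt_trichotomy (x ℓ) 0 with h | h | h
    · rw [Real.sign_of_neg h, abs_of_neg h]; ring
    · simp [h]
    · rw [Real.sign_of_pos h, abs_of_pos h]; ring
  have hr : 0 ≤ r * Λ ℓ := hℓ ▸ abs_nonneg _
  rw [Matrix.dotProduct_mulVec]
  change Real.sign (x ℓ) * ∑ j, (a ᵥ* C) j * x j ≤ r * (Λ ℓ * (posVec a ⬝ᵥ fun i => B i ℓ)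
    + ∑ j, (absVec a ᵥ* B) j * Function.update Λ ℓ 0 j)
  rw [← Finset.add_sum_erase _ _ (Finset.mem_univ ℓ),
    ← Finset.add_sum_erase _ (fun j => (absVec a ᵥ* B) j * Function.update Λ ℓ 0 j)
      (Finset.mem_univ ℓ), Function.update_self, mul_zero, zero_add, mul_add, mul_add,
    Finset.mul_sum, Finset.mul_sum]
  refine add_le_add ?_ (Finset.sum_le_sum fun j hj => ?_)
  -- Here the sign cancels against x ℓ, so a negative part of the coefficient only helps; off the
  -- diagonal absolute values are needed.
  · calc Real.sign (x ℓ) * ((a ᵥ* C) ℓ * x ℓ) = (a ᵥ* C) ℓ * (r * Λ ℓ) := by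
          rw [← hℓ, ← hsx]; ring
      _ ≤ (posVec a ⬝ᵥ fun i => B i ℓ) * (r * Λ ℓ) :=
          mul_le_mul_of_nonneg_right (vecMul_le_posVec hC0 hCB ℓ) hr
      _ = _ := by ring
  · rw [Function.update_of_ne (Finset.ne_of_mem_erase hj)]
    calc Real.sign (x ℓ) * ((a ᵥ* C) j * x j) ≤ |Real.sign (x ℓ) * ((a ᵥ* C) j * x j)| :=
          le_abs_self _
      _ = |Real.sign (x ℓ)| * (|(a ᵥ* C) j| * |x j|) := by rw [abs_mul, abs_mul]
      _ ≤ 1 * ((absVec a ᵥ* B) j * (r * Λ j)) :=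
          mul_le_mul hs (mul_le_mul (abs_vecMul_le hC0 hCB j) (hx j) (abs_nonneg _)
            ((abs_nonneg _).trans (abs_vecMul_le hC0 hCB j))) (by positivity) zero_le_one
      _ = r * ((absVec a ᵥ* B) j * Λ j) := by ring

/-! ### The error system -/

namespace OVNN

variable {n : ℕ} (N : OVNN n)

theorem rhs_apply_eq (z : Fin n → Octonion) (w : ℝ → Fin n → Octonion) (t : ℝ) (p : Fin n)
    (ℓ : Fin 8) : N.rhs w t p ℓ = -(N.d p * (w t p ℓ - z p ℓ))
      + ∑ q, (N.a p q ᵥ* octM ℓ) ⬝ᵥ (N.f q (w t q) - N.f q (z q))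
      + ∑ q, (N.b p q ᵥ* octM ℓ) ⬝ᵥ (N.g q (w (t - N.delay p q t) q) - N.g q (z q))
      + N.inputHat z p ℓ := by
  simp only [rhs, inputHat, Octonion.mul, Pi.add_apply, Pi.sub_apply, Pi.neg_apply, Pi.smul_apply,
    smul_eq_mul, Finset.sum_apply, dotProduct_sub, Finset.sum_sub_distrib, Finset.sum_add_distrib]
  ring

theorem rhs_const (z : Fin n → Octonion) (t : ℝ) (p : Fin n) (ℓ : Fin 8) :
    N.rhs (fun _ => z) t p ℓ = N.inputHat z p ℓ := by
  simp [N.rhs_apply_eq z]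

theorem delayedBound_nonneg {del : Fin n → Matrix (Fin 8) (Fin 8) ℝ} {Λ : Fin n → Fin 8 → ℝ}
    (hdel : ∀ q i j, 0 ≤ del q i j) (hΛ : ∀ q j, 0 ≤ Λ q j) (ℓ : Fin 8) (p : Fin n) :
    0 ≤ N.delayedBound del Λ ℓ p := by
  refine Finset.sum_nonneg fun q _ => Finset.sum_nonneg fun j _ => mul_nonneg ?_ (hΛ q j)
  change 0 ≤ ∑ i, |(N.b p q ᵥ* octM ℓ) i| * del q i j
  exact Finset.sum_nonneg fun i _ => mul_nonneg (abs_nonneg _) (hdel q i j)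

/-- Where the weighted maximum norm `v` of the error is attained at `(p, ℓ)`, and the delayed errors
are at most `v + 1`, the error component moves towards zero with a definite speed. -/
theorem sign_mul_velocity_le {lam del : Fin n → Matrix (Fin 8) (Fin 8) ℝ}
    (hf : ∀ q, HasPartialBounds (N.f q) (lam q)) (hg : ∀ q, HasPartialBounds (N.g q) (del q))
    {Λ : Fin n → Fin 8 → ℝ} (hΛ : ∀ q j, 0 < Λ q j) {α β : ℝ} (hα : 0 ≤ α) (hβ : 0 ≤ β)
    {z : Fin n → Octonion} {w : ℝ → Fin n → Octonion} {t v L κ κ' u : ℝ} {p : Fin n} {ℓ : Fin 8}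
    (hκ : (Λ p ℓ)⁻¹ * N.TBar lam del Λ ℓ p α β < κ)
    (hv : 0 < v) (hLv : L - 1 ≤ v) (hw : ∀ q j, |w t q j - z q j| ≤ v * Λ q j)
    (hwL : ∀ q j, |w (t - N.delay p q t) q j - z q j| ≤ L * Λ q j)
    (hk : |w t p ℓ - z p ℓ| = v * Λ p ℓ) (hu : u ∈ controlSet κ κ' (w t p ℓ - z p ℓ)) :
    Real.sign (w t p ℓ - z p ℓ) * (N.rhs w t p ℓ + u) ≤
      -(κ' - N.delayedBound del Λ ℓ p - |N.inputHat z p ℓ|) := by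
  set e := w t p ℓ - z p ℓ with he
  set D := N.delayedBound del Λ ℓ p with hD
  have hD0 : 0 ≤ D := N.delayedBound_nonneg
    (fun q i j => ((hg q).nonneg i j 0).trans ((hg q).le i j 0)) (fun q j => (hΛ q j).le) ℓ p
  have he0 : e ≠ 0 := by
    rw [← abs_pos, hk]; exact mul_pos hv (hΛ p ℓ)
  have hsabs : |Real.sign e| = 1 := by
    rcases lt_or_gt_of_ne he0 with h | h
    · simp [Real.sign_of_neg h]
    · simp [Real.sign_of_pos h]
  have hse : Real.sign e * e = v * Λ p ℓ := by
    rw [← hk]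
    rcases lt_or_gt_of_ne he0 with h | h
    · rw [Real.sign_of_neg h, abs_of_neg h]; ring
    · rw [Real.sign_of_pos h, abs_of_pos h]; ring
  have hle : ∀ y, Real.sign e * y ≤ |y| := fun y =>
    (le_abs_self _).trans (by rw [abs_mul, hsabs, one_mul])
  have hcontrol : Real.sign e * u = -(κ * (v * Λ p ℓ) + κ') := by
    obtain ⟨s, ⟨-, -, hs1, hs2⟩, rfl⟩ := hu
    rw [hk]
    rcases lt_or_gt_of_ne he0 with h | h
    · rw [Real.sign_of_neg h, hs2 h]; ring
    · rw [Real.sign_of_pos h, hs1 h]; ring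
  have hA : Real.sign e * ∑ q, (N.a p q ᵥ* octM ℓ) ⬝ᵥ (N.f q (w t q) - N.f q (z q)) ≤
      v * (Λ p ℓ * (posVec (N.a p p ᵥ* octM ℓ) ⬝ᵥ (fun i => lam p i ℓ))
        + (absVec (N.a p p ᵥ* octM ℓ) ᵥ* lam p) ⬝ᵥ Function.update (Λ p) ℓ 0
        + ∑ q ∈ Finset.univ.erase p, (absVec (N.a p q ᵥ* octM ℓ) ᵥ* lam q) ⬝ᵥ Λ q) := by
    rw [← Finset.add_sum_erase _ _ (Finset.mem_univ p), mul_add, mul_add, Finset.mul_sum,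
      Finset.mul_sum]
    refine add_le_add ?_ (Finset.sum_le_sum fun q _ => ?_)
    · obtain ⟨C, hC0, hCB, hC⟩ := (hf p).exists_sub_eq_mulVec (z p) (w t p)
      rw [hC]
      exact sign_mul_dotProduct_mulVec_le (x := w t p - z p) hC0 hCB (hw p) hk
    · obtain ⟨C, hC0, hCB, hC⟩ := (hf q).exists_sub_eq_mulVec (z q) (w t q)
      rw [hC]
      exact (hle _).trans (abs_dotProduct_mulVec_le hC0 hCB (hw q))
  have hB : Real.sign e *
      ∑ q, (N.b p q ᵥ* octM ℓ) ⬝ᵥ (N.g q (w (t - N.delay p q t) q) - N.g q (z q)) ≤ L * D := by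
    rw [hD, delayedBound, Finset.mul_sum, Finset.mul_sum]
    refine Finset.sum_le_sum fun q _ => ?_
    obtain ⟨C, hC0, hCB, hC⟩ := (hg q).exists_sub_eq_mulVec (z q) (w (t - N.delay p q t) q)
    rw [hC]
    exact (hle _).trans (abs_dotProduct_mulVec_le hC0 hCB (hwL q))
  have hT : N.TBar lam del Λ ℓ p α β < κ * Λ p ℓ := by
    rwa [inv_mul_lt_iff₀ (hΛ p ℓ), mul_comm] at hκ
  rw [TBar] at hT
  change _ + (1 + β) * D < _ at hT
  have hvT := mul_lt_mul_of_pos_left hT hv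
  have h1 : 0 ≤ v * (Λ p ℓ * α) := mul_nonneg hv.le (mul_nonneg (hΛ p ℓ).le hα)
  have h2 : 0 ≤ v * (β * D) := mul_nonneg hv.le (mul_nonneg hβ hD0)
  -- The delayed term L D splits as v D, covered by κ, plus at most D, covered by κ'.
  have h3 : (L - v) * D ≤ 1 * D := mul_le_mul_of_nonneg_right (by linarith) hD0
  have hI := hle (N.inputHat z p ℓ)
  rw [N.rhs_apply_eq z, ← he]
  have hd : Real.sign e * (N.d p * e) = N.d p * (v * Λ p ℓ) := by rw [← hse]; ring
  linarith

end OVNN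

/-! ### The weighted maximum norm of the error -/

/-- The error `w - z` at time `t`, with every component divided by its weight. -/
noncomputable def weightedError {n : ℕ} (Λ : Fin n → Fin 8 → ℝ) (z : Fin n → Octonion)
    (w : ℝ → Fin n → Octonion) (t : ℝ) : Fin n × Fin 8 → ℝ :=
  fun k => (w t k.1 k.2 - z k.1 k.2) / Λ k.1 k.2

section weightedError

variable {n : ℕ} {Λ : Fin n → Fin 8 → ℝ} {z : Fin n → Octonion} {w : ℝ → Fin n → Octonion}

theorem abs_weightedError (hΛ : ∀ p ℓ, 0 < Λ p ℓ) (t : ℝ) (p : Fin n) (ℓ : Fin 8) :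
    |w t p ℓ - z p ℓ| = |weightedError Λ z w t (p, ℓ)| * Λ p ℓ := by
  rw [weightedError, abs_div, abs_of_pos (hΛ p ℓ), div_mul_cancel₀ _ (hΛ p ℓ).ne']

theorem abs_sub_le_of_norm_weightedError_le (hΛ : ∀ p ℓ, 0 < Λ p ℓ) {t L : ℝ}
    (h : ‖weightedError Λ z w t‖ ≤ L) (p : Fin n) (ℓ : Fin 8) :
    |w t p ℓ - z p ℓ| ≤ L * Λ p ℓ := by
  rw [abs_weightedError hΛ]
  exact mul_le_mul_of_nonneg_right
    ((norm_le_pi_norm (weightedError Λ z w t) (p, ℓ)).trans h) (hΛ p ℓ).le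

theorem absolutelyContinuousOnInterval_norm_weightedError {T : ℝ}
    (h : ∀ p ℓ, AbsolutelyContinuousOnInterval (fun t => w t p ℓ) 0 T) :
    AbsolutelyContinuousOnInterval (fun t => ‖weightedError Λ z w t‖) 0 T := by
  refine AbsolutelyContinuousOnInterval.of_dist_le_sum (s := Finset.univ)
    (g := fun (k : Fin n × Fin 8) t => (Λ k.1 k.2)⁻¹ * w t k.1 k.2)
    (fun k _ => (h k.1 k.2).const_mul _) fun s t => ?_
  have hdist : ∀ k, dist (weightedError Λ z w s k) (weightedError Λ z w t k) =
      dist ((Λ k.1 k.2)⁻¹ * w s k.1 k.2) ((Λ k.1 k.2)⁻¹ * w t k.1 k.2) := fun k => by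
    rw [Real.dist_eq, Real.dist_eq, weightedError, weightedError]
    congr 1
    ring
  refine (dist_norm_norm_le _ _).trans ?_
  rw [← dist_eq_norm]
  refine (dist_pi_le_iff (Finset.sum_nonneg fun k _ => dist_nonneg)).2 fun k => ?_
  rw [hdist]
  exact Finset.single_le_sum
    (f := fun k => dist ((Λ k.1 k.2)⁻¹ * w s k.1 k.2) ((Λ k.1 k.2)⁻¹ * w t k.1 k.2))
    (fun k _ => dist_nonneg) (Finset.mem_univ k)

end weightedError

/-! ### Decay of the weighted error along solutions, and finite-time stability. -/

theorem exists_pos_forall_le {ι : Type*} [Finite ι] {f : ι → ℝ} (hf : ∀ i, 0 < f i) :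
    ∃ c > 0, ∀ i, c ≤ f i := by
  rcases isEmpty_or_nonempty ι with h | h
  · exact ⟨1, one_pos, fun i => h.elim i⟩
  · obtain ⟨i, hi⟩ := Finite.exists_min f
    exact ⟨f i, hf i, hi⟩

theorem OVNN.IsControlledSolution.decreasesNearWindowSup {n : ℕ} {N : OVNN n}
    {lam del : Fin n → Matrix (Fin 8) (Fin 8) ℝ}
    (hf : ∀ q, HasPartialBounds (N.f q) (lam q)) (hg : ∀ q, HasPartialBounds (N.g q) (del q))
    {τ : ℝ → ℝ} (hτ : HasDelayBound N.delay τ) {α β : ℝ} (hα : 0 ≤ α) (hβ : 0 ≤ β)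
    {Λ κ κ' : Fin n → Fin 8 → ℝ} (hΛ : ∀ p ℓ, 0 < Λ p ℓ)
    (hκ : ∀ p ℓ, κ p ℓ > (Λ p ℓ)⁻¹ * N.TBar lam del Λ ℓ p α β)
    {z : Fin n → Octonion} {η : ℝ}
    (hη : ∀ p ℓ, η ≤ (κ' p ℓ - N.delayedBound del Λ ℓ p - |N.inputHat z p ℓ|) / Λ p ℓ)
    {w : ℝ → Fin n → Octonion} (hw : N.IsControlledSolution κ κ' z w) :
    DecreasesNearWindowSup (fun t => ‖weightedError Λ z w t‖) τ η 0 := by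
  have hdiff : ∀ᵐ t, 0 < t → DifferentiableAt ℝ (fun t => ‖weightedError Λ z w t‖) t := by
    have h : ∀ m : ℕ, ∀ᵐ t : ℝ, t ∈ Set.uIcc (0 : ℝ) (m + 1) →
        DifferentiableAt ℝ (fun t => ‖weightedError Λ z w t‖) t := fun m =>
      (absolutelyContinuousOnInterval_norm_weightedError fun p ℓ =>
        hw.1 p ℓ (m + 1) (by positivity)).ae_differentiableAt
    filter_upwards [ae_all_iff.2 h] with t ht h0
    obtain ⟨m, hm⟩ := exists_nat_ge t
    refine ht m ?_
    rw [Set.uIcc_of_le (by positivity)]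
    exact ⟨h0.le, by linarith⟩
  filter_upwards [hdiff, hw.2] with t htd htw ht0 L hL hmax
  have hpos : 0 < ‖weightedError Λ z w t‖ := (le_max_right _ _).trans_lt hmax
  -- For n = 0 the norm is zero, so positivity supplies an index.
  have hne : Nonempty (Fin n × Fin 8) := by
    by_contra hemp
    rw [not_nonempty_iff] at hemp
    simp [Subsingleton.elim (weightedError Λ z w t) 0] at hpos
  obtain ⟨⟨p, ℓ⟩, hk⟩ : ∃ k, |weightedError Λ z w t k| = ‖weightedError Λ z w t‖ := by
    obtain ⟨k, hk⟩ := Finite.exists_max fun k => ‖weightedError Λ z w t k‖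
    exact ⟨k, le_antisymm (norm_le_pi_norm (weightedError Λ z w t) k)
      ((pi_norm_le_iff_of_nonempty _).2 hk)⟩
  obtain ⟨u, hu, hder⟩ := htw ht0 p ℓ
  rw [deriv_norm_eq_sign_mul (htd ht0) hk ((hder.sub_const (z p ℓ)).div_const (Λ p ℓ))]
  have hsign : Real.sign (weightedError Λ z w t (p, ℓ)) = Real.sign (w t p ℓ - z p ℓ) := by
    simp only [weightedError]
    rcases lt_trichotomy (w t p ℓ - z p ℓ) 0 with h | h | h
    · rw [Real.sign_of_neg h, Real.sign_of_neg (div_neg_of_neg_of_pos h (hΛ p ℓ))]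
    · rw [h, zero_div]
    · rw [Real.sign_of_pos h, Real.sign_of_pos (div_pos h (hΛ p ℓ))]
  have hmain := N.sign_mul_velocity_le hf hg hΛ hα hβ (hκ p ℓ) hpos
    ((le_max_left _ _).trans hmax.le) (abs_sub_le_of_norm_weightedError_le hΛ le_rfl)
    (fun q => abs_sub_le_of_norm_weightedError_le hΛ (hL _
      ⟨sub_le_sub_left (hτ.le p q t ht0.le) t, sub_le_self t (hτ.nonneg p q t ht0.le)⟩) q)
    (by rw [abs_weightedError hΛ, hk]) hu
  rw [hsign, ← mul_div_assoc]
  calc _ ≤ -(κ' p ℓ - N.delayedBound del Λ ℓ p - |N.inputHat z p ℓ|) / Λ p ℓ :=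
        div_le_div_of_nonneg_right hmain (hΛ p ℓ).le
    _ ≤ -η := by rw [neg_div]; exact neg_le_neg (hη p ℓ)

/-- At zero error the control may take any value in [-κ', κ'], so it can cancel the residual input Î
exactly. -/
theorem OVNN.isControlledSolution_const {n : ℕ} (N : OVNN n) {κ κ' : Fin n → Fin 8 → ℝ}
    {z : Fin n → Octonion} (hκ' : ∀ p ℓ, 0 < κ' p ℓ)
    (h : ∀ p ℓ, |N.inputHat z p ℓ| ≤ κ' p ℓ) :
    N.IsControlledSolution κ κ' z fun _ => z := by
  refine ⟨fun p ℓ T _ => (LipschitzWith.const (z p ℓ)).lipschitzOnWith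
    |>.absolutelyContinuousOnInterval, Eventually.of_forall fun t _ p ℓ => ?_⟩
  obtain ⟨h1, h2⟩ := abs_le.1 (h p ℓ)
  refine ⟨-N.inputHat z p ℓ, ⟨N.inputHat z p ℓ / κ' p ℓ, ⟨?_, ?_, ?_, ?_⟩, ?_⟩, ?_⟩
  · rwa [le_div_iff₀ (hκ' p ℓ), neg_one_mul]
  · rwa [div_le_one (hκ' p ℓ)]
  · simp
  · simp
  · rw [sub_self, abs_zero, mul_zero, zero_add, neg_mul, div_mul_cancel₀ _ (hκ' p ℓ).ne']
  · rw [N.rhs_const, add_neg_cancel]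
    exact hasDerivAt_const t (z p ℓ)

theorem theorem3 {n : ℕ} (N : OVNN n) (hd : ∀ p, 0 < N.d p)
    (lam del : Fin n → Matrix (Fin 8) (Fin 8) ℝ)
    (hf : ∀ q, HasPartialBounds (N.f q) (lam q))
    (hg : ∀ q, HasPartialBounds (N.g q) (del q))
    (τ : ℝ → ℝ) (hτ : HasDelayBound N.delay τ)
    (μ : ℝ → ℝ) (α β : ℝ) (hμ : IsRateFunction μ τ α β)
    (z : Fin n → Octonion)
    (κ κ' : Fin n → Fin 8 → ℝ) (hκ_pos : ∀ p ℓ, 0 < κ p ℓ) (hκ'_pos : ∀ p ℓ, 0 < κ' p ℓ)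
    (hΛ : ∃ Λ : Fin n → Fin 8 → ℝ, (∀ p ℓ, 0 < Λ p ℓ) ∧
      (∀ p ℓ, κ p ℓ > (Λ p ℓ)⁻¹ * N.TBar lam del Λ ℓ p α β) ∧
      (∀ p ℓ, κ' p ℓ > N.delayedBound del Λ ℓ p + |N.inputHat z p ℓ|)) :
    IsFiniteTimeStable {w | N.IsControlledSolution κ κ' z w} z := by
  obtain ⟨Λ, hΛ, hκ, hκ'⟩ := hΛ
  obtain ⟨η, hη, hηle⟩ := exists_pos_forall_le
    (f := fun k : Fin n × Fin 8 =>
      (κ' k.1 k.2 - N.delayedBound del Λ k.2 k.1 - |N.inputHat z k.1 k.2|) / Λ k.1 k.2)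
    fun k => div_pos (by linarith [hκ' k.1 k.2]) (hΛ k.1 k.2)
  have hdec : ∀ w, N.IsControlledSolution κ κ' z w →
      DecreasesNearWindowSup (fun t => ‖weightedError Λ z w t‖) τ η 0 := fun w hw =>
    hw.decreasesNearWindowSup hf hg hτ hμ.alpha_nonneg hμ.beta_nonneg hΛ hκ
      fun p ℓ => hηle (p, ℓ)
  have hAC : ∀ w, N.IsControlledSolution κ κ' z w → ∀ T > 0,
      AbsolutelyContinuousOnInterval (fun t => ‖weightedError Λ z w t‖) 0 T := fun w hw T hT =>
    absolutelyContinuousOnInterval_norm_weightedError fun p ℓ => hw.1 p ℓ T hT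
  have hD0 : ∀ p ℓ, 0 ≤ N.delayedBound del Λ ℓ p := fun p ℓ => N.delayedBound_nonneg
    (fun q i j => ((hg q).nonneg i j 0).trans ((hg q).le i j 0)) (fun q j => (hΛ q j).le) ℓ p
  refine ⟨N.isControlledSolution_const hκ'_pos fun p ℓ => ?_, fun ε hε => ?_, fun w hw => ?_⟩
  · linarith [hκ' p ℓ, hD0 p ℓ]
  · obtain ⟨m, hm, hmle⟩ := exists_pos_forall_le (f := fun k : Fin n × Fin 8 => Λ k.1 k.2)
      fun k => hΛ k.1 k.2
    obtain ⟨c, hc, hcle⟩ := exists_pos_forall_le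
      (f := fun k : Fin n × Fin 8 => ε / 2 / Λ k.1 k.2) fun k => div_pos (half_pos hε) (hΛ _ _)
    -- Dividing by weights of at least m turns c * m into the bound c on the weighted norm;
    -- multiplying back by Λ turns c into at most ε / 2.
    refine ⟨c * m, mul_pos hc hm, fun w hw hpast t ht => ?_⟩
    have hpast' : ∀ s ≤ 0, ‖weightedError Λ z w s‖ ≤ c := fun s hs => by
      refine (pi_norm_le_iff_of_nonneg hc.le).2 fun ⟨p, ℓ⟩ => ?_
      rw [weightedError, Real.norm_eq_abs, abs_div, abs_of_pos (hΛ p ℓ), div_le_iff₀ (hΛ p ℓ)]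
      calc |w s p ℓ - z p ℓ| ≤ ‖(w s - z) p‖ := norm_le_pi_norm ((w s - z) p) ℓ
        _ ≤ ‖w s - z‖ := norm_le_pi_norm (w s - z) p
        _ ≤ c * m := (hpast s hs).le
        _ ≤ c * Λ p ℓ := mul_le_mul_of_nonneg_left (hmle (p, ℓ)) hc.le
    -- The whole history is δ-close to z, so the windows need no restriction.
    have hVt := (hdec w hw).le_of_past_le hη (hAC w hw) hc.le (P := Set.univ)
      (fun _ _ => Set.subset_univ _) (fun s _ hs => hpast' s hs) (hpast' 0 le_rfl) t ht
    refine lt_of_le_of_lt ((pi_norm_le_iff_of_nonneg (half_pos hε).le).2 fun p =>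
      (pi_norm_le_iff_of_nonneg (half_pos hε).le).2 fun ℓ => ?_) (half_lt_self hε)
    exact (abs_sub_le_of_norm_weightedError_le hΛ hVt p ℓ).trans
      ((le_div_iff₀ (hΛ p ℓ)).1 (hcle (p, ℓ)))
  · obtain ⟨T, hT, hVT⟩ := (hdec w hw).exists_forall_ge_nonpos hη (hAC w hw) hτ.tendsto
    refine ⟨T, hT, fun t ht => ?_⟩
    ext p ℓ
    have h := abs_sub_le_of_norm_weightedError_le hΛ (hVT t ht) p ℓ
    rw [zero_mul] at h
    exact sub_eq_zero.1 (abs_nonpos_iff.1 h)
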